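/- **Setting.** Let $K$ be either (N) a number field; then $\mathbb G=\mathbb R$, $k=\{0\}\cup\{\text{roots of unity of }K\}$, $q=e$, $\mathcal O_K$ is the ring of integers of $K$, $S$ is the set of archimedean places of $K$, and for $\mathfrak p\in S$ with corresponding embedding $\sigma:K\to\mathbb C$ we put $\nu_{\mathfrak p}(h)=-\log|\sigma(h)|$ for $h\in K^*$, and $\deg\mathfrak p=1$ if $\mathfrak p$ is real, $\deg\mathfrak p=2$ if $\mathfrak p$ is complex; or (F) an algebraic function field of one variable with exact field of constants $k$ (an arbitrary field); then $\mathbb G=\mathbb Z$, $q>1$ is any fixed real number, $x\in K$ is a fixed element transcendental over $k$, $\mathcal O_K$ is the integral closure of $k[x]$ in $K$, $S$ is the set of places of $K/k$ lying over the infinite place of $k(x)$ (the poles of $x$), $\nu_{\mathfrak p}$ is the normalized discrete valuation of $\mathfrak p$, and $\deg\mathfrak p$ is the degree over $k$ of its residue field. Write $S=\{\mathfrak p_1,\dots,\mathfrak p_{n+1}\}$ in any fixed order, $n=|S|-1\ge 0$, and put $|h|_{\mathfrak p}=q^{-\nu_{\mathfrak p}(h)\deg\mathfrak p}$ for $h\in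 K^*$ and $|0|_{\mathfrak p}=0$. An *ideal* is a nonzero finitely generated $\mathcal O_K$-submodule of $K$. For an ideal $\mathfrak b$ and $t_1,\dots,t_{n+1}\in\mathbb G$ let $$B(\mathfrak b,(t_1,\dots,t_{n+1}))=\{h\in\mathfrak b : |h|_{\mathfrak p_i}\le q^{t_i\deg\mathfrak p_i}\text{ for }i=1,\dots,n+1\}.$$ An ideal $\mathfrak b$ is *reduced* if $1\in\mathfrak b$ and every nonzero $h\in B(\mathfrak b,(0,\dots,0))$ satisfies $|h|_{\mathfrak p}=1$ for all $\mathfrak p\in S$. For an ideal $\mathfrak a$, let $\mathrm{Red}(\mathfrak a)$ be the set of reduced ideals of the form $\frac1\mu\mathfrak a$ with $\mu\in K^*$. Write $\mathfrak b\sim\mathfrak b'$ if there is $h\in K^*$ with $\mathfrak b=h\mathfrak b'$ and $|h|_{\mathfrak p}=1$ for all $\mathfrak p\in S$; this is an equivalence relation. For $h,h'\in K^*$ write $h\le h'$ if $$(|h|_{\mathfrak p_{n+1}},|h|_{\mathfrak p_1},\dots,|h|_{\mathfrak p_n})\le(|h'|_{\mathfrak p_{n+1}},|h'|_{\mathfrak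 p_1},\dots,|h'|_{\mathfrak p_n})$$ in the lexicographic order on $\mathbb R^{n+1}$. Define * $\mathrm{fRep}^*(\mathfrak a)$: the set of all $(\mathfrak b,(t_1,\dots,t_n))\in\mathrm{Red}(\mathfrak a)\times\mathbb G^n$ with $B(\mathfrak b,(t_1,\dots,t_n,0))=k$ (the *$f^*$-representations*); * $\mathrm{fRep}(\mathfrak a)$: the set of all $([\mathfrak b]_\sim,(t_1,\dots,t_n))\in\mathrm{Red}(\mathfrak a)/_\sim\times\mathbb G^n$ such that $1$ is a smallest element of $B(\mathfrak b,(t_1,\dots,t_n,0))\setminus\{0\}$ with respect to $\le$ (the *$f$-representations*); this condition depends only on the class $[\mathfrak b]_\sim$. **Proposition 6.3.** For every ideal $\mathfrak a$, the map $$\mathrm{fRep}^*(\mathfrak a)\to\mathrm{fRep}(\mathfrak a),\qquad(\mathfrak b,(t_1,\dots,t_n))\mapsto([\mathfrak b]_\sim,(t_1,\dots,t_n))$$ is well defined and always injective. If moreover $\deg\mathfrak p_{n+1}=1$, it is a bijection. -/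

import Mathlib

open scoped Pointwise WithZero

noncomputable section

namespace Infra

/-- The data attached to the ordered list `𝔭₁, …, 𝔭ₙ₊₁` of the infinite places of a field `K`:
the group `𝔾 ⊆ ℝ` (`ℤ` or `ℝ`), the set `k ⊆ K` of constants, the base `q` of the absolute
values, the valuations `ν_{𝔭ᵢ}` on `K^*` (their value at `0` is never used) and the degrees
`deg 𝔭ᵢ`.  The indices `1, …, n+1` of the places are `0, …, n` here.
It is only used for the two systems `numberFieldSystem` and `functionFieldSystem` below. -/
structure PlaceSystem (K : Type*) [Field K] (n : ℕ) where
  G : AddSubgroup ℝ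
  const : Set K
  q : ℝ
  q_pos : 0 < q
  deg : Fin (n + 1) → ℕ
  ν : Fin (n + 1) → K → ℝ
  ν_mul : ∀ i (a b : K), a ≠ 0 → b ≠ 0 → ν i (a * b) = ν i a + ν i b

/-- `Id(O)`: the nonzero fractional ideals of `O`, that is, the nonzero finitely generated
`O`-submodules of `K`. -/
def FracIdeal (O K : Type*) [CommRing O] [Field K] [Algebra O K] : Type _ :=
  {I : Submodule O K // I.FG ∧ I ≠ ⊥}

namespace PlaceSystem

variable {O K : Type*} [CommRing O] [Field K] [Algebra O K] {n : ℕ} (P : PlaceSystem K n)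

open Classical in
/-- `|h|_𝔭 = q ^ (-ν_𝔭(h) deg 𝔭)` for `h ≠ 0`, and `|0|_𝔭 = 0`. -/
def absv (i : Fin (n + 1)) (h : K) : ℝ :=
  if h = 0 then 0 else P.q ^ (-(P.ν i h) * (P.deg i : ℝ))

theorem absv_mul (i : Fin (n + 1)) (a b : K) : P.absv i (a * b) = P.absv i a * P.absv i b := by
  by_cases ha : a = 0
  · simp [absv, ha]
  by_cases hb : b = 0
  · simp [absv, hb]
  simp only [absv, ha, hb, mul_eq_zero, or_self, if_false, P.ν_mul i a b ha hb]
  rw [← Real.rpow_add P.q_pos]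
  congr 1
  ring

theorem absv_one (i : Fin (n + 1)) : P.absv i 1 = 1 := by
  have h := P.absv_mul i 1 1
  have h0 : P.absv i 1 ≠ 0 := by
    simp only [absv, one_ne_zero, if_false]
    exact (Real.rpow_pos_of_pos P.q_pos _).ne'
  rw [mul_one] at h
  exact mul_left_cancel₀ h0 (by rw [← h, mul_one])

/-- The box `B(𝔞, (t₁, …, tₙ₊₁))`. -/
def box (a : FracIdeal O K) (t : Fin (n + 1) → ℝ) : Set K :=
  {h | h ∈ a.1 ∧ ∀ i, P.absv i h ≤ P.q ^ (t i * (P.deg i : ℝ))}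

/-- `μ ∈ 𝔞 ∖ {0}` is a minimum of `𝔞`: every `h ∈ B(𝔞, μ) = B(𝔞, (-ν_{𝔭ᵢ}(μ))ᵢ)` is zero or has
the same absolute values as `μ` at all infinite places. -/
def IsMinimum (a : FracIdeal O K) (μ : K) : Prop :=
  μ ∈ a.1 ∧ μ ≠ 0 ∧
    ∀ h ∈ P.box a (fun i => -(P.ν i μ)), h = 0 ∨ ∀ i, P.absv i h = P.absv i μ

/-- A fractional ideal is reduced if `1` is a minimum of it. -/
def IsReduced (a : FracIdeal O K) : Prop :=
  P.IsMinimum a 1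

/-- `Red(𝔞)`: the reduced ideals in the ideal class of `𝔞`. -/
def Red (a : FracIdeal O K) : Set (FracIdeal O K) :=
  {b | P.IsReduced b ∧ ∃ μ : K, μ ≠ 0 ∧ b.1 = μ⁻¹ • a.1}

/-- `𝔟 ∼ 𝔟'`: there is `h ∈ K^*` with `𝔟 = h 𝔟'` and `|h|_𝔭 = 1` for every infinite `𝔭`. -/
def Rel (b b' : FracIdeal O K) : Prop :=
  ∃ h : K, h ≠ 0 ∧ b.1 = h • b'.1 ∧ ∀ i, P.absv i h = 1

theorem rel_refl (b : FracIdeal O K) : P.Rel b b :=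
  ⟨1, one_ne_zero, (one_smul K b.1).symm, P.absv_one⟩

theorem rel_symm {b b' : FracIdeal O K} (hr : P.Rel b b') : P.Rel b' b := by
  obtain ⟨h, h0, hb, h1⟩ := hr
  refine ⟨h⁻¹, inv_ne_zero h0, ?_, fun i => ?_⟩
  · rw [hb, smul_smul, inv_mul_cancel₀ h0, one_smul]
  · have := P.absv_mul i h⁻¹ h
    rw [inv_mul_cancel₀ h0, P.absv_one, h1, mul_one] at this
    exact this.symm

theorem rel_trans {b b' b'' : FracIdeal O K} (h₁ : P.Rel b b') (h₂ : P.Rel b' b'') :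
    P.Rel b b'' := by
  obtain ⟨g, g0, hb, g1⟩ := h₁
  obtain ⟨h, h0, hb', h1⟩ := h₂
  refine ⟨g * h, mul_ne_zero g0 h0, ?_, fun i => ?_⟩
  · rw [hb, hb', smul_smul]
  · rw [P.absv_mul, g1, h1, mul_one]

/-- The equivalence relation `∼` restricted to `Red(𝔞)`. -/
def redSetoid (a : FracIdeal O K) : Setoid (P.Red a) where
  r b b' := P.Rel b.1 b'.1
  iseqv := ⟨fun b => P.rel_refl b.1, fun h => P.rel_symm h, fun h h' => P.rel_trans h h'⟩

/-- `Red(𝔞)/∼`. -/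
def RedQuot (a : FracIdeal O K) : Type _ := Quotient (P.redSetoid a)

/-- The class `[𝔟]_∼` of `𝔟 ∈ Red(𝔞)`. -/
def redClass {a : FracIdeal O K} (b : P.Red a) : P.RedQuot a := Quotient.mk (P.redSetoid a) b

/-- The box `B(𝔟, (t₁, …, tₙ, 0))` for `t ∈ 𝔾ⁿ`. -/
def boxZero (b : FracIdeal O K) (t : Fin n → P.G) : Set K :=
  P.box b (Fin.snoc (α := fun _ => ℝ) (fun i => (t i : ℝ)) 0)

/-- `fRep*(𝔞)`: the pairs `(𝔟, t) ∈ Red(𝔞) × 𝔾ⁿ` with `B(𝔟, (t₁, …, tₙ, 0)) = k`. -/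
def fRepAst (a : FracIdeal O K) : Set (P.Red a × (Fin n → P.G)) :=
  {p | P.boxZero p.1.1 p.2 = P.const}

/-- The vector `(|h|_{𝔭ₙ₊₁}, |h|_{𝔭₁}, …, |h|_{𝔭ₙ})`, to be compared lexicographically. -/
def lexVec (h : K) : Lex (Fin (n + 1) → ℝ) :=
  toLex (Fin.cons (α := fun _ => ℝ) (P.absv (Fin.last n) h) (fun i => P.absv i.castSucc h))

/-- The total preorder on `K^*`: lexicographic comparison of
`(|h|_{𝔭ₙ₊₁}, |h|_{𝔭₁}, …, |h|_{𝔭ₙ})`. -/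
def Le (h h' : K) : Prop := P.lexVec h ≤ P.lexVec h'

/-- `1` is a smallest element of `B(𝔟, (t₁, …, tₙ, 0)) ∖ {0}` with respect to the preorder. -/
def OneIsSmallest (b : FracIdeal O K) (t : Fin n → P.G) : Prop :=
  1 ∈ P.boxZero b t \ {0} ∧ ∀ h ∈ P.boxZero b t \ {0}, P.Le 1 h

theorem oneIsSmallest_of_rel {b b' : FracIdeal O K} (hb' : (1 : K) ∈ b'.1) (hr : P.Rel b b')
    (t : Fin n → P.G) (hb : P.OneIsSmallest b t) : P.OneIsSmallest b' t := by
  obtain ⟨c, c0, hc, c1⟩ := hr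
  obtain ⟨⟨⟨-, h2⟩, h3⟩, h4⟩ := hb
  refine ⟨⟨⟨hb', h2⟩, h3⟩, fun h hh => ?_⟩
  have hv : ∀ i, P.absv i (c * h) = P.absv i h := fun i => by rw [P.absv_mul, c1, one_mul]
  have hmem : c * h ∈ P.boxZero b t \ {0} := by
    refine ⟨⟨?_, fun i => ?_⟩, mul_ne_zero c0 hh.2⟩
    · rw [hc]
      exact Submodule.smul_mem_pointwise_smul h c b'.1 hh.1.1
    · rw [hv]
      exact hh.1.2 i
  have hle := h4 _ hmem
  unfold Le lexVec at hle ⊢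
  simpa only [hv] using hle

/-- `fRep(𝔞)`: the pairs `([𝔟]_∼, t) ∈ Red(𝔞)/∼ × 𝔾ⁿ` such that `1` is a smallest element of
`B(𝔟, (t₁, …, tₙ, 0)) ∖ {0}`; this depends only on the class of `𝔟`. -/
def fRep (a : FracIdeal O K) : Set (P.RedQuot a × (Fin n → P.G)) :=
  {p | Quotient.lift (s := P.redSetoid a) (fun b : P.Red a => P.OneIsSmallest b.1 p.2)
    (fun b b' hr => propext
      ⟨P.oneIsSmallest_of_rel b'.2.1.1 hr p.2,
        P.oneIsSmallest_of_rel b.2.1.1 (P.rel_symm hr) p.2⟩) p.1}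

/-- The map `(𝔟, t) ↦ ([𝔟]_∼, t)`. -/
def toClass (a : FracIdeal O K) (p : P.Red a × (Fin n → P.G)) :
    P.RedQuot a × (Fin n → P.G) :=
  (P.redClass p.1, p.2)

end PlaceSystem

/-! ### Number fields -/

/-- The system of the infinite places of a number field, in a chosen order `e`: `𝔾 = ℝ`, `k` is
the set of roots of unity together with `0`, `q = exp 1`, `deg 𝔭` is `1` for real and `2` for
complex `𝔭`, and `ν_𝔭(h) = -log |σ(h)|` for an embedding `σ` belonging to `𝔭`. -/
def numberFieldSystem (K : Type*) [Field K] [NumberField K] {n : ℕ}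
    (e : Fin (n + 1) ≃ NumberField.InfinitePlace K) : PlaceSystem K n where
  G := ⊤
  const := {h | h = 0 ∨ IsOfFinOrder h}
  q := Real.exp 1
  q_pos := Real.exp_pos 1
  deg i := (e i).mult
  ν i h := -Real.log (e i h)
  ν_mul i a b ha hb := by
    rw [map_mul, Real.log_mul (by simpa using ha) (by simpa using hb), neg_add]

/-! ### Function fields -/

/-- A place of `K / k`, given by its normalized (that is, surjective) discrete valuation, which
is trivial on `k`.  The valuation is written multiplicatively. -/
structure FFPlace (k K : Type*) [Field k] [Field K] [Algebra k K] where
  val : Valuation K ℤᵐ⁰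
  surj : Function.Surjective val
  val_const : ∀ c : k, c ≠ 0 → val (algebraMap k K c) = 1

namespace FFPlace

variable {k K : Type*} [Field k] [Field K] [Algebra k K] (p : FFPlace k K)

/-- The normalized additive valuation `ν_𝔭(h) ∈ ℤ` for `h ≠ 0`. -/
def ν (h : K) : ℤ := -WithZero.log (p.val h)

/-- The inclusion of `k` in the valuation ring `𝒪_𝔭`. -/
def constHom : k →+* p.val.valuationSubring :=
  (algebraMap k K).codRestrict p.val.valuationSubring (fun c => by
    rw [Valuation.mem_valuationSubring_iff]
    by_cases hc : c = 0
    · simp [hc]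
    · exact (p.val_const c hc).le)

/-- `deg 𝔭 = [𝒪_𝔭 / 𝔪_𝔭 : k]`. -/
def degree : ℕ :=
  letI : Algebra k (IsLocalRing.ResidueField p.val.valuationSubring) :=
    ((IsLocalRing.residue p.val.valuationSubring).comp p.constHom).toAlgebra
  Module.finrank k (IsLocalRing.ResidueField p.val.valuationSubring)

end FFPlace

/-- The infinite places of `K / k` with respect to `x`: those lying over the infinite place of
`k(x)`, that is, those at which `x` has a pole. -/
def infinitePlaces (k : Type*) {K : Type*} [Field k] [Field K] [Algebra k K] (x : K) :
    Set (FFPlace k K) :=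
  {p | p.ν x < 0}

/-- `𝒪_K`: the integral closure of `k[x]` in `K`. -/
abbrev integersAt (k : Type*) {K : Type*} [Field k] [Field K] [Algebra k K] (x : K) :
    Subalgebra (Algebra.adjoin k {x}) K :=
  integralClosure (Algebra.adjoin k {x}) K

/-- The system of the infinite places of a function field `K / k` with respect to `x`, in a
chosen order `e`: `𝔾 = ℤ ⊆ ℝ`, the constants are the elements of `k`, and `q > 1`. -/
def functionFieldSystem {k K : Type*} [Field k] [Field K] [Algebra k K] {x : K} {n : ℕ}
    (q : ℝ) (hq : 1 < q) (e : Fin (n + 1) ≃ infinitePlaces k x) : PlaceSystem K n where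
  G := (Int.castAddHom ℝ).range
  const := Set.range (algebraMap k K)
  q := q
  q_pos := zero_lt_one.trans hq
  deg i := (e i).1.degree
  ν i h := ((e i).1.ν h : ℝ)
  ν_mul i a b ha hb := by
    unfold FFPlace.ν
    rw [map_mul, WithZero.log_mul (by simpa using ha) (by simpa using hb)]
    push_cast
    ring

end Infra

end

/-! Two properties of the constants give the first two claims: every nonzero constant is a unit of
`O` and has absolute value 1 at all infinite places (`HasUnitConstants`). If the box equals `k`, its
nonzero elements therefore all tie with 1 in the preorder, so the map is well defined. If 𝔟 = h𝔟'
with all |h| = 1, then h lies in 𝔟 because 1 ∈ 𝔟', hence in the box, hence in `k`; so h is a unit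
and 𝔟 = 𝔟'.

For surjectivity only the leading lexicographic entry matters. The box bounds |h| by 1 at the last
place and minimality of 1 bounds it below, so every nonzero h in the box has absolute value exactly
1 there (`absv_last_eq_one_of_mem`). Degree one at this place then forces h ∈ `k`: over a number
field the place is real, so h = ±1; over a function field the residue field is `k`, and subtracting
the constant congruent to h leaves a box element that is too small to be nonzero. -/

namespace Infra

open NumberField

/-! ### Arguments common to both kinds of field -/

namespace PlaceSystem

variable {O K : Type*} [CommRing O] [Field K] [Algebra O K] {n : ℕ} {P : PlaceSystem K n}

/-- `k` consists of `0` and of images of units of `O` having absolute value `1` at all places. -/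
structure HasUnitConstants (O : Type*) [CommRing O] [Algebra O K] (P : PlaceSystem K n) :
    Prop where
  zero_mem : (0 : K) ∈ P.const
  one_mem : (1 : K) ∈ P.const
  isUnit : ∀ c ∈ P.const, c ≠ 0 → ∃ u : Oˣ, algebraMap O K u = c
  absv_eq_one : ∀ c ∈ P.const, c ≠ 0 → ∀ i, P.absv i c = 1

theorem absv_zero (i : Fin (n + 1)) : P.absv i 0 = 0 := by simp [absv]

theorem absv_nonneg (i : Fin (n + 1)) (h : K) : 0 ≤ P.absv i h := by
  unfold absv
  split_ifs
  · exact le_rfl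
  · exact Real.rpow_nonneg P.q_pos.le _

theorem mem_fRep_iff {a : FracIdeal O K} (b : P.Red a) (t : Fin n → P.G) :
    (P.redClass b, t) ∈ P.fRep a ↔ P.OneIsSmallest b.1 t := Iff.rfl

theorem redClass_eq_iff {a : FracIdeal O K} (b b' : P.Red a) :
    P.redClass b = P.redClass b' ↔ P.Rel b.1 b'.1 := Quotient.eq (r := P.redSetoid a)

theorem smul_submodule_eq_of_unit (u : Oˣ) (M : Submodule O K) :
    algebraMap O K u • M = M := by
  have key : ∀ v : Oˣ, algebraMap O K v • M ≤ M := by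
    intro v y hy
    obtain ⟨m, hm, rfl⟩ := (Submodule.mem_smul_pointwise_iff_exists _ _ _).1 hy
    rw [smul_eq_mul, ← Algebra.smul_def]
    exact M.smul_mem _ hm
  refine le_antisymm (key u) fun y hy => ?_
  refine (Submodule.mem_smul_pointwise_iff_exists _ _ _).2
    ⟨algebraMap O K (u⁻¹ : Oˣ) * y, ?_, ?_⟩
  · rw [← Algebra.smul_def]
    exact M.smul_mem _ hy
  · rw [smul_eq_mul, ← mul_assoc, ← map_mul, Units.mul_inv, map_one, one_mul]

theorem le_absv_last_of_le {h h' : K} (hle : P.Le h h') :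
    P.absv (Fin.last n) h ≤ P.absv (Fin.last n) h' := by
  rcases eq_or_lt_of_le hle with heq | hlt
  · exact (congrFun (congrArg ofLex heq) 0).le
  · obtain ⟨i, hi, hlt⟩ := hlt
    rcases Fin.eq_zero_or_eq_succ i with rfl | ⟨j, rfl⟩
    · exact hlt.le
    -- Entry 0 of the vector belongs to the last place; a first difference at a later index leaves
    -- it equal.
    · exact (hi 0 (Fin.succ_pos j)).le

/-- The upper bound is the final coordinate 0 of the box; the lower bound is the leading entry of
the comparison with 1. -/
theorem absv_last_eq_one_of_mem {b : FracIdeal O K} {t : Fin n → P.G} (hb : P.OneIsSmallest b t)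
    {h : K} (hh : h ∈ P.boxZero b t) (h0 : h ≠ 0) : P.absv (Fin.last n) h = 1 := by
  refine le_antisymm ?_ ?_
  · simpa using hh.2 (Fin.last n)
  · simpa only [absv_one] using le_absv_last_of_le (hb.2 h ⟨hh, h0⟩)

namespace HasUnitConstants

theorem mem_of_one_mem (hP : P.HasUnitConstants O) {c : K} (hc : c ∈ P.const) {b : FracIdeal O K} (hb : (1 : K) ∈ b.1) :
    c ∈ b.1 := by
  by_cases h0 : c = 0
  · exact h0 ▸ b.1.zero_mem
  obtain ⟨u, rfl⟩ := hP.isUnit c hc h0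
  rw [Algebra.algebraMap_eq_smul_one]
  exact b.1.smul_mem _ hb

theorem absv_le_one (hP : P.HasUnitConstants O) {c : K} (hc : c ∈ P.const) (i : Fin (n + 1)) : P.absv i c ≤ 1 := by
  by_cases h0 : c = 0
  · rw [h0, absv_zero]
    exact zero_le_one
  · exact (hP.absv_eq_one c hc h0 i).le

theorem const_subset_boxZero (hP : P.HasUnitConstants O) {b : FracIdeal O K} {t : Fin n → P.G}
    (hb : (1 : K) ∈ P.boxZero b t) : P.const ⊆ P.boxZero b t := fun _ hc =>
  ⟨hP.mem_of_one_mem hc hb.1, fun i => (hP.absv_le_one hc i).trans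
    (by simpa only [absv_one] using hb.2 i)⟩

theorem mapsTo_toClass (hP : P.HasUnitConstants O) (a : FracIdeal O K) :
    Set.MapsTo (P.toClass a) (P.fRepAst a) (P.fRep a) := by
  rintro ⟨b, t⟩ (hbt : P.boxZero b.1 t = P.const)
  refine (mem_fRep_iff b t).2 ⟨⟨hbt ▸ hP.one_mem, one_ne_zero⟩, fun h hh => ?_⟩
  have h1 := hP.absv_eq_one h (hbt ▸ hh.1) hh.2
  simp only [Le, lexVec, h1, absv_one, le_refl]

theorem injOn_toClass (hP : P.HasUnitConstants O) (a : FracIdeal O K) : Set.InjOn (P.toClass a) (P.fRepAst a) := by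
  rintro ⟨b, t⟩ (hbt : P.boxZero b.1 t = P.const) ⟨b', t'⟩ - heq
  obtain ⟨hcl, rfl⟩ := Prod.mk.inj heq
  obtain ⟨h, h0, hb, h1⟩ := (redClass_eq_iff b b').1 hcl
  have hmem : h ∈ b.1.1 := by
    rw [hb]
    simpa using Submodule.smul_mem_pointwise_smul (1 : K) h b'.1.1 b'.2.1.1
  have h1mem : (1 : K) ∈ P.boxZero b.1 t := hbt ▸ hP.one_mem
  -- All absolute values of h agree with those of 1, so h satisfies the same box inequalities.
  have hbox : h ∈ P.boxZero b.1 t :=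
    ⟨hmem, fun i => by simpa only [h1, absv_one] using h1mem.2 i⟩
  obtain ⟨u, rfl⟩ := hP.isUnit h (hbt ▸ hbox) h0
  rw [smul_submodule_eq_of_unit] at hb
  rw [Subtype.ext (Subtype.ext hb)]

/-- The inclusion of `k` in the box is automatic once 1 is in the box, so surjectivity reduces to
`hsub`, the only point where the two kinds of field differ. -/
theorem bijOn_toClass (hP : P.HasUnitConstants O) (a : FracIdeal O K)
    (hsub : ∀ (b : FracIdeal O K) (t : Fin n → P.G), P.OneIsSmallest b t →
      P.boxZero b t ⊆ P.const) :
    Set.BijOn (P.toClass a) (P.fRepAst a) (P.fRep a) := by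
  refine ⟨hP.mapsTo_toClass a, hP.injOn_toClass a, ?_⟩
  rintro ⟨c, t⟩ hc
  obtain ⟨b, rfl⟩ := Quotient.exists_rep (s := P.redSetoid a) c
  have hb : P.OneIsSmallest b.1 t := hc
  exact ⟨(b, t), (hsub b.1 t hb).antisymm (hP.const_subset_boxZero hb.1.1), rfl⟩

end HasUnitConstants

end PlaceSystem

/-! ### Number fields -/

section NumberField

variable {K : Type*} [Field K] [NumberField K] {n : ℕ} (e : Fin (n + 1) ≃ InfinitePlace K)

theorem numberFieldSystem_absv (i : Fin (n + 1)) {h : K} (h0 : h ≠ 0) :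
    (numberFieldSystem K e).absv i h = e i h ^ (e i).mult := by
  have hpos : 0 < e i h := (InfinitePlace.pos_iff).2 h0
  simp only [PlaceSystem.absv, h0, if_false, numberFieldSystem, neg_neg]
  rw [Real.rpow_mul (Real.exp_pos 1).le, Real.exp_one_rpow, Real.exp_log hpos, Real.rpow_natCast]

theorem numberFieldSystem_hasUnitConstants :
    (numberFieldSystem K e).HasUnitConstants (𝓞 K) where
  zero_mem := Or.inl rfl
  one_mem := Or.inr IsOfFinOrder.one
  isUnit := by
    rintro c (hc | hc) h0
    · exact absurd hc h0
    obtain ⟨m, hm, hpow⟩ := isOfFinOrder_iff_pow_eq_one.1 hc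
    have hint : IsIntegral ℤ c := IsIntegral.of_pow hm (hpow ▸ isIntegral_one)
    have hu : IsUnit (⟨c, hint⟩ : 𝓞 K) :=
      IsUnit.of_pow_eq_one (RingOfIntegers.ext hpow) hm.ne'
    exact ⟨hu.unit, rfl⟩
  absv_eq_one := by
    rintro c (hc | hc) h0 i
    · exact absurd hc h0
    obtain ⟨m, hm, hpow⟩ := isOfFinOrder_iff_pow_eq_one.1 hc
    have hv : e i c ^ m = 1 := by rw [← map_pow, hpow, map_one]
    rw [numberFieldSystem_absv e i h0,
      (pow_eq_one_iff_of_nonneg (apply_nonneg _ _) hm.ne').1 hv, one_pow]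

/-- The image under the real embedding is a real number of absolute value 1, so its square is 1, and
the embedding is injective. -/
theorem sq_eq_one_of_isReal {F : Type*} [Field F] {w : InfinitePlace F} (hw : w.IsReal) {h : F}
    (h1 : w h = 1) : h ^ 2 = 1 := by
  have hn : ‖InfinitePlace.embedding_of_isReal hw h‖ = 1 := by
    rw [InfinitePlace.norm_embedding_of_isReal, h1]
  apply (InfinitePlace.embedding_of_isReal hw).injective
  rw [map_pow, map_one, ← sq_abs, ← Real.norm_eq_abs, hn, one_pow]

theorem numberFieldSystem_boxZero_subset
    (hdeg : (numberFieldSystem K e).deg (Fin.last n) = 1) (b : FracIdeal (𝓞 K) K)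
    (t : Fin n → (numberFieldSystem K e).G) (hb : (numberFieldSystem K e).OneIsSmallest b t) :
    (numberFieldSystem K e).boxZero b t ⊆ (numberFieldSystem K e).const := by
  intro h hh
  by_cases h0 : h = 0
  · exact Or.inl h0
  have hmult : (e (Fin.last n)).mult = 1 := hdeg
  have hreal : (e (Fin.last n)).IsReal := by
    by_contra hr
    simp [InfinitePlace.mult, hr] at hmult
  have h1 := PlaceSystem.absv_last_eq_one_of_mem hb hh h0
  rw [numberFieldSystem_absv e _ h0, hmult, pow_one] at h1
  exact Or.inr (isOfFinOrder_iff_pow_eq_one.2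
    ⟨2, two_pos, sq_eq_one_of_isReal hreal h1⟩)

end NumberField

/-! ### Valuations and residues at a place of a function field -/

namespace FFPlace

variable {k K : Type*} [Field k] [Field K] [Algebra k K] (p : FFPlace k K)

theorem ν_eq_zero_of_val_eq_one {h : K} (h1 : p.val h = 1) : p.ν h = 0 := by
  simp [ν, h1]

theorem val_eq_exp {h : K} (h0 : h ≠ 0) : p.val h = WithZero.exp (-p.ν h) := by
  rw [ν, neg_neg, WithZero.exp_log ((Valuation.ne_zero_iff _).2 h0)]

theorem val_le_val_iff {g h : K} (hg : g ≠ 0) (hh : h ≠ 0) :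
    p.val g ≤ p.val h ↔ p.ν h ≤ p.ν g := by
  rw [p.val_eq_exp hg, p.val_eq_exp hh, WithZero.exp_le_exp, neg_le_neg_iff]

/-- At a place of degree one every integral element is congruent to a constant. -/
theorem exists_const_val_sub_lt_one (hp : p.degree = 1) {h : K} (hh : p.val h ≤ 1) :
    ∃ c : k, p.val (h - algebraMap k K c) < 1 := by
  let _ : Algebra k (IsLocalRing.ResidueField p.val.valuationSubring) :=
    ((IsLocalRing.residue p.val.valuationSubring).comp p.constHom).toAlgebra
  have hfin : Module.finrank k (IsLocalRing.ResidueField p.val.valuationSubring) = 1 := hp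
  let h' : p.val.valuationSubring := ⟨h, hh⟩
  -- The residue field is a line over `k` spanned by 1, so the residue of h is a multiple c · 1.
  obtain ⟨c, hc⟩ := (finrank_eq_one_iff_of_nonzero'
    (1 : IsLocalRing.ResidueField p.val.valuationSubring) one_ne_zero).1 hfin
    (IsLocalRing.residue _ h')
  refine ⟨c, ?_⟩
  have hres : IsLocalRing.residue p.val.valuationSubring (h' - p.constHom c) = 0 := by
    rw [map_sub, ← hc, Algebra.smul_def, mul_one, sub_eq_zero]
    rfl
  rw [IsLocalRing.residue_eq_zero_iff] at hres
  exact (Valuation.mem_maximalIdeal_iff _ _).1 hres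

end FFPlace

/-! ### Function fields -/

section FunctionField

variable {k K : Type*} [Field k] [Field K] [Algebra k K] {x : K} {n : ℕ} {q : ℝ} (hq : 1 < q)
  (e : Fin (n + 1) ≃ infinitePlaces k x)

theorem functionFieldSystem_absv (i : Fin (n + 1)) {h : K} (h0 : h ≠ 0) :
    (functionFieldSystem q hq e).absv i h =
      q ^ (-((e i).1.ν h : ℝ) * ((e i).1.degree : ℝ)) := by
  simp only [PlaceSystem.absv, h0, if_false]
  rfl

theorem functionFieldSystem_absv_le_absv (i : Fin (n + 1)) {g h : K} (h0 : h ≠ 0)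
    (hgh : (e i).1.val g ≤ (e i).1.val h) :
    (functionFieldSystem q hq e).absv i g ≤ (functionFieldSystem q hq e).absv i h := by
  by_cases g0 : g = 0
  · rw [g0, PlaceSystem.absv_zero]
    exact PlaceSystem.absv_nonneg _ _
  rw [functionFieldSystem_absv hq e i h0, functionFieldSystem_absv hq e i g0]
  have hν : ((e i).1.ν h : ℝ) ≤ (e i).1.ν g :=
    Int.cast_le.2 (((e i).1.val_le_val_iff g0 h0).1 hgh)
  gcongr
  exact hq.le

theorem functionFieldSystem_val_eq_one_of_absv_eq_one {i : Fin (n + 1)}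
    (hdeg : (functionFieldSystem q hq e).deg i = 1) {h : K} (h0 : h ≠ 0)
    (h1 : (functionFieldSystem q hq e).absv i h = 1) : (e i).1.val h = 1 := by
  have hd : (e i).1.degree = 1 := hdeg
  -- The degree must be nonzero for the absolute value to determine the valuation; `finrank` would
  -- give 0 for an infinite residue extension.
  rw [functionFieldSystem_absv hq e i h0, hd, Nat.cast_one, mul_one,
    ← Real.rpow_zero q, Real.rpow_right_inj (zero_lt_one.trans hq) hq.ne', neg_eq_zero, Int.cast_eq_zero] at h1
  rw [(e i).1.val_eq_exp h0, h1, neg_zero, WithZero.exp_zero]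

theorem functionFieldSystem_hasUnitConstants :
    (functionFieldSystem q hq e).HasUnitConstants (integersAt k x) where
  zero_mem := ⟨0, map_zero _⟩
  one_mem := ⟨1, map_one _⟩
  isUnit := by
    rintro _ ⟨c, rfl⟩ h0
    have hc : c ≠ 0 := fun hc => h0 (hc ▸ map_zero _)
    exact ⟨(Units.mk0 c hc).map ((algebraMap (Algebra.adjoin k {x}) (integersAt k x)).comp
      (algebraMap k (Algebra.adjoin k {x}))).toMonoidHom, rfl⟩
  absv_eq_one := by
    rintro _ ⟨c, rfl⟩ h0 i
    have hc : c ≠ 0 := fun hc => h0 (hc ▸ map_zero _)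
    rw [functionFieldSystem_absv hq e i h0,
      (e i).1.ν_eq_zero_of_val_eq_one ((e i).1.val_const c hc)]
    simp

/-- The box is stable under subtracting constants by the ultrametric inequality. If h differed from
the constant c congruent to it, then h - c would be a nonzero box element of valuation both < 1 and
= 1 at the last place. -/
theorem functionFieldSystem_boxZero_subset
    (hdeg : (functionFieldSystem q hq e).deg (Fin.last n) = 1)
    (b : FracIdeal (integersAt k x) K) (t : Fin n → (functionFieldSystem q hq e).G)
    (hb : (functionFieldSystem q hq e).OneIsSmallest b t) :
    (functionFieldSystem q hq e).boxZero b t ⊆ (functionFieldSystem q hq e).const := by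
  have hP := functionFieldSystem_hasUnitConstants hq e
  intro h hh
  by_cases h0 : h = 0
  · exact h0 ▸ hP.zero_mem
  have hval := functionFieldSystem_val_eq_one_of_absv_eq_one hq e hdeg h0
    (PlaceSystem.absv_last_eq_one_of_mem hb hh h0)
  obtain ⟨c, hc⟩ := (e (Fin.last n)).1.exists_const_val_sub_lt_one hdeg hval.le
  have hcbox := hP.const_subset_boxZero hb.1.1 ⟨c, rfl⟩
  have hmem : h - algebraMap k K c ∈ (functionFieldSystem q hq e).boxZero b t := by
    refine ⟨b.1.sub_mem hh.1 hcbox.1, fun i => ?_⟩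
    -- Comparing absolute values through valuations needs a nonzero upper element, so c = 0 is
    -- treated apart.
    by_cases hc0 : algebraMap k K c = 0
    · rw [hc0, sub_zero]
      exact hh.2 i
    rcases le_max_iff.1 ((e i).1.val.map_sub h (algebraMap k K c)) with hle | hle
    · exact (functionFieldSystem_absv_le_absv hq e i h0 hle).trans (hh.2 i)
    · exact (functionFieldSystem_absv_le_absv hq e i hc0 hle).trans (hcbox.2 i)
  refine ⟨c, ?_⟩
  by_contra hne
  have hsub : h - algebraMap k K c ≠ 0 := sub_ne_zero.2 (Ne.symm hne)
  exact hc.ne (functionFieldSystem_val_eq_one_of_absv_eq_one hq e hdeg hsub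
    (PlaceSystem.absv_last_eq_one_of_mem hb hmem hsub))

end FunctionField

end Infra

theorem proposition6p3 :
    -- number fields
    (∀ (K : Type*) [Field K] [NumberField K] (n : ℕ)
      (e : Fin (n + 1) ≃ NumberField.InfinitePlace K)
      (a : Infra.FracIdeal (NumberField.RingOfIntegers K) K),
      Set.MapsTo ((Infra.numberFieldSystem K e).toClass a)
        ((Infra.numberFieldSystem K e).fRepAst a) ((Infra.numberFieldSystem K e).fRep a) ∧
      Set.InjOn ((Infra.numberFieldSystem K e).toClass a)
        ((Infra.numberFieldSystem K e).fRepAst a) ∧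
      ((Infra.numberFieldSystem K e).deg (Fin.last n) = 1 →
        Set.BijOn ((Infra.numberFieldSystem K e).toClass a)
          ((Infra.numberFieldSystem K e).fRepAst a) ((Infra.numberFieldSystem K e).fRep a))) ∧
    -- function fields with exact constant field `k`
    (∀ (k K : Type*) [Field k] [Field K] [Algebra k K] (x : K),
      Transcendental k x →
      FiniteDimensional (IntermediateField.adjoin k {x}) K →
      (∀ c : K, IsAlgebraic k c → c ∈ Set.range (algebraMap k K)) →
      ∀ (q : ℝ) (hq : 1 < q) (n : ℕ) (e : Fin (n + 1) ≃ Infra.infinitePlaces k x)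
        (a : Infra.FracIdeal (Infra.integersAt k x) K),
      Set.MapsTo ((Infra.functionFieldSystem q hq e).toClass a)
        ((Infra.functionFieldSystem q hq e).fRepAst a)
        ((Infra.functionFieldSystem q hq e).fRep a) ∧
      Set.InjOn ((Infra.functionFieldSystem q hq e).toClass a)
        ((Infra.functionFieldSystem q hq e).fRepAst a) ∧
      ((Infra.functionFieldSystem q hq e).deg (Fin.last n) = 1 →
        Set.BijOn ((Infra.functionFieldSystem q hq e).toClass a)
          ((Infra.functionFieldSystem q hq e).fRepAst a)
          ((Infra.functionFieldSystem q hq e).fRep a))) := by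
  refine ⟨fun K _ _ n e a => ?_, fun k K _ _ _ x _ _ _ q hq n e a => ?_⟩
  · have hP := Infra.numberFieldSystem_hasUnitConstants e
    exact ⟨hP.mapsTo_toClass a, hP.injOn_toClass a, fun hdeg =>
      hP.bijOn_toClass a (Infra.numberFieldSystem_boxZero_subset e hdeg)⟩
  · have hP := Infra.functionFieldSystem_hasUnitConstants hq e
    exact ⟨hP.mapsTo_toClass a, hP.injOn_toClass a, fun hdeg =>
      hP.bijOn_toClass a (Infra.functionFieldSystem_boxZero_subset hq e hdeg)⟩
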